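/- Let $d\ge 1$ and let $\mathbb{L}^d=(\mathbb{Z}^d,\mathbb{E}^d)$ be the nearest-neighbour graph, where $\{x,y\}\in\mathbb{E}^d$ iff $\sum_{i=1}^d|x_i-y_i|=1$. A subgraph $G=(\mathbb{Z}^d,E)$ with $E\subset\mathbb{E}^d$ is identified with an element of $\{0,1\}^{\mathbb{E}^d}$, which carries the product $\sigma$-field. Write $C(x)$ for the connected component of $x$ in $G$ (its cluster), $I=I(G)=\{x\in\mathbb{Z}^d : |C(x)|=+\infty\}$, and $\Lambda_n=\{x\in\mathbb{Z}^d : \max_i|x_i|\le n\}$. For a subgraph $G$, a probability measure $\nu$ on $\mathbb{R}$ and $r\in\mathbb{R}$, let $P^{G,\nu,r}$ be the unique probability measure on $\mathbb{R}^{\mathbb{Z}^d}$ under which the coordinates $X(x)$ satisfy: $X(x)$ has law $\nu$ if $|C(x)|<+\infty$ and law $\delta_r$ otherwise; coordinates at sites in pairwise different clusters are independent; and coordinates at sites in the same cluster are almost surely equal. Let $\phi$ be a probability measure on $\{0,1\}^{\mathbb{E}^d}$ such that * (E) $\phi$ is invariant and ergodic under the translations of $\mathbb{Z}^d$; * (M)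 there is a real $\alpha>d$ with $\sum_{k\ge 1}k^{\alpha}\,\phi(|C(0)|=k)<+\infty$. Let $\nu$ be a probability measure on $\mathbb{R}$ with a finite second moment, let $m=\int x\,d\nu(x)$ and $\sigma^2=\int(x-m)^2\,d\nu(x)$, and let $r\in\mathbb{R}$. Put $$\chi^f(\phi)=\sum_{k=1}^{+\infty}k\,\phi(|C(0)|=k).$$ Then $\chi^f(\phi)<+\infty$, and for $\phi$-almost every $G$, under $P^{G,\nu,r}$, $$\frac{1}{|\Lambda_n|^{1/2}}\sum_{x\in\Lambda_n\setminus I(G)}\bigl(X(x)-m\bigr)\ \Longrightarrow\ \mathcal{N}\bigl(0,\chi^f(\phi)\,\sigma^2\bigr)\qquad(n\to\infty)$$ in distribution, where $\mathcal{N}(0,0)$ denotes $\delta_0$. -/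

import Mathlib

open MeasureTheory ProbabilityTheory Filter
open scoped ENNReal NNReal Topology

namespace RandomGraphColouring

/-- The vertex set `ℤ^d`. -/
abbrev Site (d : ℕ) : Type := Fin d → ℤ

/-- The nearest-neighbour graph on `ℤ^d`: `x ~ y` iff `∑ |x_i - y_i| = 1`. -/
def lattice (d : ℕ) : SimpleGraph (Site d) where
  Adj x y := ∑ i, |x i - y i| = 1
  symm := ⟨fun x y h => by simpa only [abs_sub_comm] using h⟩
  loopless := ⟨fun x h => by simp at h⟩

/-- The set `E^d` of bonds, as a type. -/
abbrev Bond (d : ℕ) : Type := (lattice d).edgeSet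

/-- Subgraphs of the lattice with full vertex set, encoded as elements of `{0,1}^{E^d}`. -/
def Config (d : ℕ) : Type := Bond d → Bool

/-- The product (= Borel) σ-field on `{0,1}^{E^d}`. -/
instance instMeasurableSpaceConfig (d : ℕ) : MeasurableSpace (Config d) :=
  inferInstanceAs (MeasurableSpace (Bond d → Bool))

/-- The translate `k + e` of a bond `e`. -/
def shiftBond {d : ℕ} (k : Site d) (e : Bond d) : Bond d :=
  ⟨Sym2.map (fun x => k + x) e.1, by
    obtain ⟨e, he⟩ := e
    induction e using Sym2.ind with
    | _ x y => simpa [lattice] using he⟩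

/-- The translation action of `ℤ^d` on configurations: `(k +ᵥ ω)_e = ω_{k+e}`. -/
instance instAddActionConfig (d : ℕ) : AddAction (Site d) (Config d) where
  vadd k ω := fun e => ω (shiftBond k e)
  zero_vadd ω := by
    funext e
    change ω (shiftBond 0 e) = ω e
    congr 1
    apply Subtype.ext
    simp [shiftBond]
  add_vadd k l ω := by
    funext e
    change ω (shiftBond (k + l) e) = ω (shiftBond l (shiftBond k e))
    congr 1
    apply Subtype.ext
    simp [shiftBond, Sym2.map_map, add_left_comm, add_assoc]

/-- The graph on `ℤ^d` formed by the open bonds of `ω`. -/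
def openGraph {d : ℕ} (ω : Config d) : SimpleGraph (Site d) where
  Adj x y := ∃ h : (lattice d).Adj x y, ω ⟨s(x, y), h⟩ = true
  symm := ⟨by
    rintro x y ⟨h, hω⟩
    refine ⟨h.symm, ?_⟩
    rw [← hω]
    congr 1
    exact Subtype.ext Sym2.eq_swap⟩
  loopless := ⟨by
    rintro x ⟨h, -⟩
    exact h.ne rfl⟩

/-- The cluster `C(x)`: the sites linked to `x` by an open path. -/
def cluster {d : ℕ} (ω : Config d) (x : Site d) : Set (Site d) :=
  {y | (openGraph ω).Reachable x y}

/-- `I(ω)`: the sites whose cluster is infinite. -/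
def infiniteSites {d : ℕ} (ω : Config d) : Set (Site d) :=
  {x | (cluster ω x).Infinite}

/-- The box `Λ_n = {x : ‖x‖_∞ ≤ n}`. -/
noncomputable def box (d n : ℕ) : Finset (Site d) :=
  Finset.Icc (fun _ => -(n : ℤ)) (fun _ => (n : ℤ))

theorem mem_box {d n : ℕ} {x : Site d} : x ∈ box d n ↔ ∀ i, |x i| ≤ (n : ℤ) := by
  simp only [box, Finset.mem_Icc, Pi.le_def, abs_le]
  exact ⟨fun h i => ⟨h.1 i, h.2 i⟩, fun h => ⟨fun i => (h i).1, fun i => (h i).2⟩⟩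

/-- Condition (M): the finite clusters have a moment of some order `α > d`.
The term `k = 0` vanishes. -/
def MomentCondition {d : ℕ} (φ : Measure (Config d)) : Prop :=
  ∃ α : ℝ, (d : ℝ) < α ∧
    ∑' k : ℕ, (k : ℝ≥0∞) ^ α * φ {ω | (cluster ω 0).encard = (k : ℕ∞)} < ∞

/-- `χ^f(φ) = ∑_k k φ(|C(0)| = k)`. -/
noncomputable def chiF {d : ℕ} (φ : Measure (Config d)) : ℝ≥0∞ :=
  ∑' k : ℕ, (k : ℝ≥0∞) * φ {ω | (cluster ω 0).encard = (k : ℕ∞)}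

open Classical in
/-- The colouring of `ℤ^d` that gives every site with a finite cluster the colour attached to its
cluster and gives the colour `r` to all sites with an infinite cluster. -/
noncomputable def paint {d : ℕ} (ω : Config d) (r : ℝ)
    (c : (openGraph ω).ConnectedComponent → ℝ) : Site d → ℝ :=
  fun x => if x ∈ infiniteSites ω then r else c ((openGraph ω).connectedComponentMk x)

theorem measurable_paint {d : ℕ} (ω : Config d) (r : ℝ) : Measurable (paint ω r) := by
  refine measurable_pi_lambda _ fun x => ?_
  unfold paint
  split_ifs
  · exact measurable_const
  · exact measurable_pi_apply _

/-- The colour-probability `P^{G,ν,r}` on `ℝ^{ℤ^d}`: the clusters are coloured independently with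
law `ν`, except that infinite clusters receive the colour `r`. -/
noncomputable def colourMeasure {d : ℕ} (ω : Config d) (ν : Measure ℝ) [IsProbabilityMeasure ν]
    (r : ℝ) : Measure (Site d → ℝ) :=
  (Measure.infinitePi fun _ : (openGraph ω).ConnectedComponent => ν).map (paint ω r)

instance instIsProbabilityMeasureColourMeasure {d : ℕ} (ω : Config d) (ν : Measure ℝ) [IsProbabilityMeasure ν]
    (r : ℝ) : IsProbabilityMeasure (colourMeasure ω ν r) :=
  Measure.isProbabilityMeasure_map (measurable_paint ω r).aemeasurable

/-- The properties that characterise the colour-probability: the law of each colour,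
independence over sites in pairwise distinct clusters, equality within a cluster. -/
structure IsColourMeasure {d : ℕ} (ω : Config d) (ν : Measure ℝ) (r : ℝ)
    (P : Measure (Site d → ℝ)) : Prop where
  law_finite : ∀ x, x ∉ infiniteSites ω → P.map (fun X => X x) = ν
  law_infinite : ∀ x, x ∈ infiniteSites ω → P.map (fun X => X x) = Measure.dirac r
  indep : ∀ S : Set (Site d), S.Pairwise (fun x y => ¬ (openGraph ω).Reachable x y) →
    iIndepFun (fun (x : S) (X : Site d → ℝ) => X x) P
  eq_of_reachable : ∀ x y, (openGraph ω).Reachable x y → ∀ᵐ X ∂P, X x = X y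

theorem mem_infiniteSites_congr {d : ℕ} {ω : Config d} {x y : Site d}
    (h : (openGraph ω).Reachable x y) : x ∈ infiniteSites ω ↔ y ∈ infiniteSites ω := by
  have : cluster ω x = cluster ω y := by
    ext z
    exact ⟨fun hz => h.symm.trans hz, fun hz => h.trans hz⟩
  simp [infiniteSites, this]

theorem isColourMeasure_colourMeasure {d : ℕ} (ω : Config d) (ν : Measure ℝ)
    [IsProbabilityMeasure ν] (r : ℝ) : IsColourMeasure ω ν r (colourMeasure ω ν r) where
  law_finite x hx := by
    rw [colourMeasure, Measure.map_map (measurable_pi_apply x) (measurable_paint ω r)]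
    have : (fun X : Site d → ℝ => X x) ∘ paint ω r =
        fun c => c ((openGraph ω).connectedComponentMk x) := by
      funext c
      simp [paint, hx]
    rw [this]
    exact Measure.infinitePi_map_eval _ _
  law_infinite x hx := by
    rw [colourMeasure, Measure.map_map (measurable_pi_apply x) (measurable_paint ω r)]
    have : (fun X : Site d → ℝ => X x) ∘ paint ω r = fun _ => r := by
      funext c
      simp [paint, hx]
    rw [this, Measure.map_const, measure_univ, one_smul]
  indep S hS := by
    classical
    let Q := Measure.infinitePi fun _ : (openGraph ω).ConnectedComponent => ν
    have h0 : iIndepFun (fun (i : (openGraph ω).ConnectedComponent)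
        (c : (openGraph ω).ConnectedComponent → ℝ) => c i) Q :=
      iIndepFun_infinitePi (X := fun _ x => x) fun _ => measurable_id
    have hinj : Function.Injective fun x : S => (openGraph ω).connectedComponentMk x.1 := by
      intro x y h
      by_contra hne
      exact hS x.2 y.2 (fun h' => hne (Subtype.ext h')) (SimpleGraph.ConnectedComponent.exact h)
    have h1 := (h0.precomp hinj).comp
      (fun (x : S) (t : ℝ) => if x.1 ∈ infiniteSites ω then r else t)
      (fun x => by split_ifs <;> fun_prop)
    have h2 : iIndepFun (fun (x : S) c => paint ω r c x.1) Q := h1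
    have hp : ∀ x : S, Measurable fun c => paint ω r c x.1 :=
      fun x => (measurable_pi_apply x.1).comp (measurable_paint ω r)
    rw [iIndepFun_iff_map_fun_eq_infinitePi_map hp] at h2
    rw [iIndepFun_iff_map_fun_eq_infinitePi_map (by fun_prop), colourMeasure,
      Measure.map_map (by fun_prop) (measurable_paint ω r)]
    refine Eq.trans h2 ?_
    congr 1
    funext x
    rw [Measure.map_map (by fun_prop) (measurable_paint ω r)]
    rfl
  eq_of_reachable x y h := by
    rw [colourMeasure, ae_map_iff (measurable_paint ω r).aemeasurable
      (measurableSet_eq_fun (measurable_pi_apply x) (measurable_pi_apply y))]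
    refine Eventually.of_forall fun c => ?_
    have hiff := mem_infiniteSites_congr h
    have hmk := SimpleGraph.ConnectedComponent.sound h
    by_cases hy : y ∈ infiniteSites ω
    · simp [paint, hy, hiff.2 hy]
    · simp [paint, hy, mt hiff.1 hy, hmk]

/-- `colourMeasure` is the only probability measure with the characterising properties. -/
theorem IsColourMeasure.eq_colourMeasure {d : ℕ} {ω : Config d} {ν : Measure ℝ}
    [IsProbabilityMeasure ν] {r : ℝ} {P : Measure (Site d → ℝ)} [IsProbabilityMeasure P]
    (hP : IsColourMeasure ω ν r P) : P = colourMeasure ω ν r := by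
  let rep : (openGraph ω).ConnectedComponent → Site d := Quot.out
  have hrep : ∀ c, (openGraph ω).connectedComponentMk (rep c) = c := fun c => Quot.out_eq c
  let back : ((openGraph ω).ConnectedComponent → ℝ) → Site d → ℝ :=
    fun c x => c ((openGraph ω).connectedComponentMk x)
  have hback : Measurable back := measurable_pi_lambda _ fun x => measurable_pi_apply _
  have key : ∀ (Q : Measure (Site d → ℝ)) [IsProbabilityMeasure Q], IsColourMeasure ω ν r Q →
      Q = (Measure.infinitePi fun c => Q.map fun X => X (rep c)).map back := by
    intro Q _ hQ
    let S : Set (Site d) := Set.range rep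
    have hS : S.Pairwise fun x y => ¬ (openGraph ω).Reachable x y := by
      rintro _ ⟨a, rfl⟩ _ ⟨b, rfl⟩ hne h
      apply hne
      have := SimpleGraph.ConnectedComponent.sound h
      rw [hrep, hrep] at this
      rw [this]
    have hi : Function.Injective fun c => (⟨rep c, c, rfl⟩ : S) := by
      intro a b h
      have h' : rep a = rep b := congrArg Subtype.val h
      rw [← hrep a, ← hrep b, h']
    have h1 : iIndepFun (fun c (X : Site d → ℝ) => X (rep c)) Q := (hQ.indep S hS).precomp hi
    rw [iIndepFun_iff_map_fun_eq_infinitePi_map (by fun_prop)] at h1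
    rw [← h1, Measure.map_map hback (by fun_prop)]
    have hae : (back ∘ fun X c => X (rep c)) =ᵐ[Q] id := by
      have : ∀ᵐ X ∂Q, ∀ x, X (rep ((openGraph ω).connectedComponentMk x)) = X x :=
        ae_all_iff.2 fun x => hQ.eq_of_reachable _ _
          (SimpleGraph.ConnectedComponent.exact (hrep _))
      filter_upwards [this] with X hX
      funext x
      exact hX x
    rw [Measure.map_congr hae, Measure.map_id]
  have hC := isColourMeasure_colourMeasure ω ν r
  have hlaw : ∀ x, P.map (fun X => X x) = (colourMeasure ω ν r).map fun X => X x := by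
    intro x
    by_cases hx : x ∈ infiniteSites ω
    · rw [hP.law_infinite x hx, hC.law_infinite x hx]
    · rw [hP.law_finite x hx, hC.law_finite x hx]
  rw [key P hP, key _ hC]
  simp only [hlaw]

open Classical in
/-- `|Λ_n|^{-1/2} ∑_{x ∈ Λ_n \ I(ω)} (X(x) - m)`. -/
noncomputable def normalizedSum {d : ℕ} (ω : Config d) (m : ℝ) (n : ℕ) (X : Site d → ℝ) : ℝ :=
  (∑ x ∈ (box d n).filter (fun x => x ∉ infiniteSites ω), (X x - m)) /
    Real.sqrt ((box d n).card : ℝ)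

end RandomGraphColouring

namespace RandomGraphColouring

/-! ### A central limit theorem for weighted i.i.d. sums -/

section CentralLimit

/-! For fixed `G` the normalized sum is `∑ C, a_C (c_C - m)` over the finite clusters meeting `Λ_n`,
with i.i.d. colours `c_C` and weights `a_C = |C ∩ Λ_n| / |Λ_n|^{1/2}`. Comparing characteristic
functions with Gaussian ones (`tendsto_prod_charFun`), it suffices that `∑ a_C² → χ^f` and `max a_C
→ 0`.

Counting by sites, `∑ a_C²` is the average over the sites of `Λ_n` in finite clusters of `|C(x) ∩
Λ_n|`. Up to boundary effects this is the spatial average of `|C(x)| 1_{|C(x)| < ∞}`, whose limit is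
`χ^f` by the pointwise ergodic theorem; condition (M) supplies the integrability. Truncating cluster
sizes at `M` controls the boundary, since a cluster of at most `M` sites meeting `Λ_n` lies in
`Λ_{n+M}`. The truncation also bounds the largest weight: a cluster larger than `M` contributes at
least `|C ∩ Λ_n|²` to the sum lost by truncating (`sq_clusterCount_le`).

The ergodic theorem for `ℤ^d` (`averagesConverge_of_integrable`) combines a maximal inequality,
obtained from a Vitali covering, with convergence on a dense class. In `L²`, constants and
coboundaries suffice, because a function orthogonal to all coboundaries of indicators is invariant,
hence constant. -/

theorem norm_prod_sub_prod_le_sum {ι : Type*} (s : Finset ι) (z w : ι → ℂ)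
    (hz : ∀ i ∈ s, ‖z i‖ ≤ 1) (hw : ∀ i ∈ s, ‖w i‖ ≤ 1) :
    ‖∏ i ∈ s, z i - ∏ i ∈ s, w i‖ ≤ ∑ i ∈ s, ‖z i - w i‖ := by
  classical
  induction s using Finset.induction_on with
  | empty => simp
  | insert i s hi ih =>
    rw [Finset.prod_insert hi, Finset.prod_insert hi, Finset.sum_insert hi]
    have ih' := ih (fun j hj => hz j (Finset.mem_insert_of_mem hj))
      (fun j hj => hw j (Finset.mem_insert_of_mem hj))
    have hwi := hw i (Finset.mem_insert_self i s)
    have hzp : ‖∏ j ∈ s, z j‖ ≤ 1 := by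
      rw [norm_prod]
      exact Finset.prod_le_one (fun _ _ => norm_nonneg _)
        fun j hj => hz j (Finset.mem_insert_of_mem hj)
    -- Exchange one factor at a time; the remaining factors have modulus at most `1`.
    calc ‖z i * ∏ j ∈ s, z j - w i * ∏ j ∈ s, w j‖
        = ‖(z i - w i) * ∏ j ∈ s, z j + w i * (∏ j ∈ s, z j - ∏ j ∈ s, w j)‖ := by ring_nf
      _ ≤ ‖z i - w i‖ * ‖∏ j ∈ s, z j‖ + ‖w i‖ * ‖∏ j ∈ s, z j - ∏ j ∈ s, w j‖ := by
          rw [← norm_mul, ← norm_mul]; exact norm_add_le _ _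
      _ ≤ ‖z i - w i‖ * 1 + 1 * ∑ j ∈ s, ‖z j - w j‖ := by gcongr
      _ = _ := by ring

/-- Second order expansion at `0` of the characteristic function of a centred law. -/
theorem charFun_sub_isLittleO {μ : Measure ℝ} [IsProbabilityMeasure μ] (hμ : MemLp id 2 μ)
    (h0 : ∫ x, x ∂μ = 0) :
    (fun t : ℝ => charFun μ t - (1 - ((∫ x, x ^ 2 ∂μ : ℝ) : ℂ) * t ^ 2 / 2))
      =o[𝓝 0] fun t => t ^ 2 := by
  have h := taylor_isLittleO_univ (x₀ := (0 : ℝ)) (n := 2) (f := charFun μ)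
    (contDiff_charFun hμ)
  have h2 : ∀ t : ℝ, taylorWithinEval (charFun μ) 2 Set.univ 0 t =
      1 - ((∫ x, x ^ 2 ∂μ : ℝ) : ℂ) * t ^ 2 / 2 := by
    intro t
    have := taylorWithinEval_charFun_two_zero (P := μ) (X := id) aemeasurable_id
      (by simpa using hμ) t
    simpa [h0] using this
  simp only [h2, sub_zero] at h
  exact h

/-- Once all arguments are small, the `i`-th factors differ by at most `δ * a n i ^ 2`, and these
errors add up to about `δ * v`. -/
theorem tendsto_prod_sub_prod {ι : Type*} {ψ₁ ψ₂ : ℝ → ℂ} (h₁ : ∀ t, ‖ψ₁ t‖ ≤ 1)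
    (h₂ : ∀ t, ‖ψ₂ t‖ ≤ 1) (h : (fun t => ψ₁ t - ψ₂ t) =o[𝓝 0] fun t => t ^ 2)
    (s : ℕ → Finset ι) (a : ℕ → ι → ℝ) {v : ℝ}
    (hv : Tendsto (fun n => ∑ i ∈ s n, a n i ^ 2) atTop (𝓝 v))
    (ha : ∀ ε > 0, ∀ᶠ n in atTop, ∀ i ∈ s n, |a n i| ≤ ε) :
    Tendsto (fun n => ∏ i ∈ s n, ψ₁ (a n i) - ∏ i ∈ s n, ψ₂ (a n i)) atTop (𝓝 0) := by
  have hv0 : 0 ≤ v := ge_of_tendsto' hv fun n => Finset.sum_nonneg fun i _ => sq_nonneg _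
  rw [Metric.tendsto_nhds]
  intro ε hε
  have hδ : 0 < ε / (v + 2) := by positivity
  have hsmall := h.def hδ
  obtain ⟨η, hη, hball⟩ := Metric.eventually_nhds_iff.1 hsmall
  filter_upwards [ha (η / 2) (by positivity), hv.eventually (gt_mem_nhds (lt_add_one v))]
    with n hn hvn
  rw [dist_zero_right]
  calc _ ≤ ∑ i ∈ s n, ‖ψ₁ (a n i) - ψ₂ (a n i)‖ :=
        norm_prod_sub_prod_le_sum _ _ _ (fun _ _ => h₁ _) (fun _ _ => h₂ _)
    _ ≤ ∑ i ∈ s n, ε / (v + 2) * a n i ^ 2 := by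
        refine Finset.sum_le_sum fun i hi => ?_
        have := hball (y := a n i) (by
          rw [dist_zero_right, Real.norm_eq_abs]; linarith [hn i hi])
        simpa using this
    _ = ε / (v + 2) * ∑ i ∈ s n, a n i ^ 2 := by rw [Finset.mul_sum]
    _ ≤ ε / (v + 2) * (v + 1) := by gcongr
    _ < ε := by
        rw [div_mul_eq_mul_div, div_lt_iff₀ (by positivity)]
        nlinarith

/-- Central limit theorem for weighted sums of independent identically distributed variables:
if the sum of the squared weights converges and the largest weight tends to `0`, then the
characteristic functions converge to that of a Gaussian. -/
theorem tendsto_prod_charFun {ι : Type*} {μ : Measure ℝ} [IsProbabilityMeasure μ]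
    (hμ : MemLp id 2 μ) (h0 : ∫ x, x ∂μ = 0) (s : ℕ → Finset ι) (a : ℕ → ι → ℝ) {v : ℝ}
    (hv : Tendsto (fun n => ∑ i ∈ s n, a n i ^ 2) atTop (𝓝 v))
    (ha : ∀ ε > 0, ∀ᶠ n in atTop, ∀ i ∈ s n, |a n i| ≤ ε) (t : ℝ) :
    Tendsto (fun n => ∏ i ∈ s n, charFun μ (a n i * t)) atTop
      (𝓝 (charFun (gaussianReal 0 (v * ∫ x, x ^ 2 ∂μ).toNNReal) t)) := by
  set q := ∫ x, x ^ 2 ∂μ with hq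
  have hq0 : 0 ≤ q := integral_nonneg fun x => sq_nonneg x
  have hv0 : 0 ≤ v := ge_of_tendsto' hv fun n => Finset.sum_nonneg fun i _ => sq_nonneg _
  have hg2 : ∫ x, x ^ 2 ∂(gaussianReal 0 q.toNNReal) = q := by
    have h := variance_eq_integral (μ := gaussianReal 0 q.toNNReal) (X := id) aemeasurable_id
    simpa [variance_id_gaussianReal, hq0] using h.symm
  -- The Gaussian of variance `q` has the same first two moments as `μ`, so the second order
  -- expansions cancel.
  have hlo : (fun t : ℝ => charFun μ t - charFun (gaussianReal 0 q.toNNReal) t)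
      =o[𝓝 0] fun t => t ^ 2 := by
    have h1 := charFun_sub_isLittleO hμ h0
    have h2 := charFun_sub_isLittleO (μ := gaussianReal 0 q.toNNReal)
      (memLp_id_gaussianReal 2) (by simp)
    rw [hg2] at h2
    refine (h1.sub h2).congr_left fun t => ?_
    rw [← hq]; ring
  have hlim := tendsto_prod_sub_prod (norm_charFun_le_one) (norm_charFun_le_one) hlo s
    (fun n i => a n i * t) (v := v * t ^ 2)
    (by simpa only [mul_pow, ← Finset.sum_mul] using hv.mul_const (t ^ 2))
    (fun ε hε => by
      filter_upwards [ha (ε / (|t| + 1)) (by positivity)] with n hn i hi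
      rw [abs_mul]
      calc |a n i| * |t| ≤ ε / (|t| + 1) * (|t| + 1) := by
            gcongr
            · exact hn i hi
            · linarith
        _ = ε := by field_simp)
  -- For Gaussian factors the product is exact: the exponents add up to a multiple of `∑ a²`.
  have hgauss : Tendsto (fun n => ∏ i ∈ s n, charFun (gaussianReal 0 q.toNNReal) (a n i * t))
      atTop (𝓝 (charFun (gaussianReal 0 (v * q).toNNReal) t)) := by
    have : ∀ n, ∏ i ∈ s n, charFun (gaussianReal 0 q.toNNReal) (a n i * t) =
        Complex.exp (((-((∑ i ∈ s n, a n i ^ 2) * q * t ^ 2 / 2) : ℝ) : ℂ)) := by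
      intro n
      simp only [charFun_gaussianReal, Real.coe_toNNReal _ hq0]
      rw [← Complex.exp_sum]
      congr 1
      push_cast
      rw [Finset.sum_mul, Finset.sum_mul, Finset.sum_div, ← Finset.sum_neg_distrib]
      exact Finset.sum_congr rfl fun i _ => by ring
    simp only [this]
    have h3 : charFun (gaussianReal 0 (v * q).toNNReal) t =
        Complex.exp (((-(v * q * t ^ 2 / 2) : ℝ) : ℂ)) := by
      rw [charFun_gaussianReal, Real.coe_toNNReal _ (mul_nonneg hv0 hq0)]
      congr 1
      push_cast
      ring
    rw [h3]
    refine (Complex.continuous_exp.comp Complex.continuous_ofReal).continuousAt.tendsto.comp ?_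
    exact (((hv.mul_const q).mul_const (t ^ 2)).div_const 2).neg
  simpa using hlim.add hgauss

end CentralLimit

/-! ### Boxes: cardinalities, boundary layers and a covering estimate -/

section Box

variable {d : ℕ}

theorem card_box (d n : ℕ) : (box d n).card = (2 * n + 1) ^ d := by
  have h : ((n : ℤ) + 1 + n).toNat = 2 * n + 1 := by omega
  simp [box, Pi.card_Icc, h]

theorem card_box_pos (d n : ℕ) : 0 < (box d n).card := by
  rw [card_box]; positivity

theorem card_box_mul_le (d n c : ℕ) (hc : 1 ≤ c) :
    (box d (c * n)).card ≤ c ^ d * (box d n).card := by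
  rw [card_box, card_box, ← mul_pow]
  exact Nat.pow_le_pow_left (by nlinarith) d

theorem box_mono {n n' : ℕ} (h : n ≤ n') : box d n ⊆ box d n' := by
  intro x hx
  rw [mem_box] at hx ⊢
  exact fun i => (hx i).trans (by exact_mod_cast h)

theorem add_mem_box {n n' : ℕ} {x y : Site d} (hx : x ∈ box d n) (hy : y ∈ box d n') :
    x + y ∈ box d (n + n') := by
  rw [mem_box] at hx hy ⊢
  intro i
  have := abs_add_le (x i) (y i)
  have hx := hx i
  have hy := hy i
  push_cast
  simp only [Pi.add_apply]
  omega

theorem neg_mem_box {n : ℕ} {x : Site d} (hx : x ∈ box d n) : -x ∈ box d n := by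
  rw [mem_box] at hx ⊢
  simpa using hx

theorem zero_mem_box (d n : ℕ) : (0 : Site d) ∈ box d n := by
  simp [mem_box]

theorem exists_mem_box (x : Site d) : ∃ n, x ∈ box d n := by
  refine ⟨∑ i, (x i).natAbs, mem_box.2 fun i => ?_⟩
  have := Finset.single_le_sum (f := fun i => (x i).natAbs) (fun _ _ => Nat.zero_le _)
    (Finset.mem_univ i)
  rw [Int.abs_eq_natAbs]
  exact_mod_cast this

/-- The Følner property: a boundary layer of fixed width is negligible. -/
theorem tendsto_card_box_add_div (d K : ℕ) :
    Tendsto (fun n => ((box d (n + K)).card : ℝ) / (box d n).card) atTop (𝓝 1) := by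
  have h : ∀ n : ℕ, ((box d (n + K)).card : ℝ) / (box d n).card =
      (1 + 2 * K * (1 / (2 * n + 1 : ℝ))) ^ d := by
    intro n
    rw [card_box, card_box]
    push_cast
    rw [← div_pow]
    congr 1
    field_simp
    ring
  simp only [h]
  have h1 : Tendsto (fun n : ℕ => 1 / (2 * n + 1 : ℝ)) atTop (𝓝 0) := by
    refine tendsto_const_nhds.div_atTop ?_
    exact tendsto_atTop_add_const_right _ _
      (tendsto_natCast_atTop_atTop.const_mul_atTop (by norm_num))
  simpa using ((h1.const_mul (2 * K : ℝ)).const_add 1).pow d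

theorem tendsto_card_box (hd : 1 ≤ d) :
    Tendsto (fun n => ((box d n).card : ℝ)) atTop atTop := by
  refine tendsto_atTop_mono (fun n => ?_) tendsto_natCast_atTop_atTop
  rw [card_box]
  have : n ≤ (2 * n + 1) ^ d :=
    (by omega : n ≤ 2 * n + 1).trans (Nat.le_self_pow (by omega) _)
  exact_mod_cast this

/-- A Vitali covering estimate for boxes of bounded size. -/
theorem mul_card_le_of_sum_box_ge (F : Site d → ℝ≥0∞) (c : ℝ≥0∞) {L N : ℕ}
    (B : Finset (Site d)) (hB : B ⊆ box d L) (r : Site d → ℕ) (hr : ∀ x ∈ B, r x ≤ N)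
    (hF : ∀ x ∈ B, c * (box d (r x)).card ≤ ∑ k ∈ box d (r x), F (k + x)) :
    c * B.card ≤ 3 ^ d * ∑ y ∈ box d (L + N), F y := by
  classical
  let T : Site d → ℕ → Finset (Site d) := fun x n => (box d n).image (· + x)
  have hTcard : ∀ x n, (T x n).card = (box d n).card := fun x n =>
    Finset.card_image_of_injective _ (add_left_injective x)
  obtain ⟨u, huB, hdisj, hcov⟩ := Vitali.exists_disjoint_subfamily_covering_enlargement
    (fun x => (T x (r x) : Set (Site d))) (B : Set (Site d)) (fun x => (r x : ℝ)) 2 (by norm_num)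
    (fun _ _ => Nat.cast_nonneg _) N (fun x hx => by exact_mod_cast hr x hx)
    (fun x _ => ⟨x, by simpa [T] using zero_mem_box d (r x)⟩)
  let U : Finset (Site d) := B.filter (· ∈ u)
  have hcover : B ⊆ U.biUnion fun b => T b (3 * r b) := by
    intro a ha
    obtain ⟨b, hb, ⟨y, hya, hyb⟩, hle⟩ := hcov a ha
    refine Finset.mem_biUnion.2 ⟨b, Finset.mem_filter.2 ⟨huB hb, hb⟩, ?_⟩
    obtain ⟨p, hp, rfl⟩ := Finset.mem_image.1 (Finset.mem_coe.1 hya)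
    obtain ⟨q, hq, hqp⟩ := Finset.mem_image.1 (Finset.mem_coe.1 hyb)
    have hle' : r a ≤ 2 * r b := by exact_mod_cast hle
    refine Finset.mem_image.2 ⟨q + -p, ?_, ?_⟩
    -- The boxes around `a` and `b` meet, so `a - b` lies in the box of radius `r b + r a`, and `r a
    -- ≤ 2 * r b`: hence the factor `3`.
    · exact box_mono (by omega) (add_mem_box hq (neg_mem_box hp))
    · have : q + b = p + a := hqp
      calc q + -p + b = (q + b) - p := by abel
        _ = a := by rw [this]; abel
  have hcardB : B.card ≤ ∑ b ∈ U, 3 ^ d * (box d (r b)).card :=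
    (Finset.card_le_card hcover).trans (Finset.card_biUnion_le.trans
      (Finset.sum_le_sum fun b _ => by rw [hTcard]; exact card_box_mul_le d _ 3 (by norm_num)))
  have hdisjU : (U : Set (Site d)).PairwiseDisjoint fun b => T b (r b) := by
    intro a ha b hb hab
    have := hdisj (Finset.mem_filter.1 (Finset.mem_coe.1 ha)).2
      (Finset.mem_filter.1 (Finset.mem_coe.1 hb)).2 hab
    exact Finset.disjoint_coe.1 this
  have hsub : (U.biUnion fun b => T b (r b)) ⊆ box d (L + N) := by
    intro y hy
    obtain ⟨b, hb, hy⟩ := Finset.mem_biUnion.1 hy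
    obtain ⟨p, hp, rfl⟩ := Finset.mem_image.1 hy
    have hbB := (Finset.mem_filter.1 hb).1
    have := add_mem_box (hB hbB) (box_mono (hr b hbB) hp)
    rwa [add_comm b p] at this
  calc c * B.card ≤ c * ∑ b ∈ U, (3 : ℝ≥0∞) ^ d * (box d (r b)).card := by
        gcongr
        exact_mod_cast hcardB
    _ = 3 ^ d * ∑ b ∈ U, c * (box d (r b)).card := by
        rw [← Finset.mul_sum, ← Finset.mul_sum]; ring
    _ ≤ 3 ^ d * ∑ b ∈ U, ∑ y ∈ T b (r b), F y := by
        gcongr with b hb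
        rw [Finset.sum_image (fun _ _ _ _ h => add_left_injective b h)]
        exact hF b (Finset.mem_filter.1 hb).1
    _ = 3 ^ d * ∑ y ∈ U.biUnion (fun b => T b (r b)), F y := by
        rw [Finset.sum_biUnion hdisjU]
    _ ≤ _ := by
        gcongr

end Box

/-! ### The maximal inequality for box averages -/

section Maximal

variable {d : ℕ} {Ω : Type*} [MeasurableSpace Ω] [AddAction (Site d) Ω]
  [MeasurableConstVAdd (Site d) Ω] {μ : Measure Ω} [VAddInvariantMeasure (Site d) Ω μ]

theorem ae_forall_vadd {p : Ω → Prop} (h : ∀ᵐ ω ∂μ, p ω) :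
    ∀ᵐ ω ∂μ, ∀ k : Site d, p (k +ᵥ ω) :=
  ae_all_iff.2 fun k => (measurePreserving_vadd k μ).quasiMeasurePreserving.ae h

/-- Transference: the covering estimate is applied to `y ↦ f (y +ᵥ ω)` on each orbit and integrated,
all translates having the same integral by invariance. -/
theorem maximal_inequality_of_measurable {f : Ω → ℝ≥0∞} (hf : Measurable f) (c : ℝ≥0∞) :
    c * μ {ω | ∃ n, c * (box d n).card ≤ ∑ k ∈ box d n, f (k +ᵥ ω)} ≤ 6 ^ d * ∫⁻ ω, f ω ∂μ := by
  classical
  -- The covering needs bounded radii; the bound `N` is removed at the end by monotone continuity.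
  let E : ℕ → Set Ω := fun N =>
    {ω | ∃ n ≤ N, c * (box d n).card ≤ ∑ k ∈ box d n, f (k +ᵥ ω)}
  have hfk : ∀ k : Site d, Measurable fun ω => f (k +ᵥ ω) :=
    fun k => hf.comp (measurable_const_vadd k)
  have hEm : ∀ N, MeasurableSet (E N) := by
    intro N
    have : E N = ⋃ n ∈ Finset.range (N + 1),
        {ω | c * (box d n).card ≤ ∑ k ∈ box d n, f (k +ᵥ ω)} := by
      ext ω; simp [E]
    rw [this]
    exact Finset.measurableSet_biUnion _ fun n _ =>
      measurableSet_le measurable_const (Finset.measurable_sum _ fun k _ => hfk k)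
  have hmono : Monotone E := fun a b hab ω ⟨n, hn, h⟩ => ⟨n, hn.trans hab, h⟩
  have hU : {ω | ∃ n, c * (box d n).card ≤ ∑ k ∈ box d n, f (k +ᵥ ω)} = ⋃ N, E N := by
    ext ω
    simp only [E, Set.mem_ofPred_eq, Set.mem_iUnion]
    exact ⟨fun ⟨n, h⟩ => ⟨n, n, le_rfl, h⟩, fun ⟨_, n, _, h⟩ => ⟨n, h⟩⟩
  rw [hU, hmono.measure_iUnion, ENNReal.mul_iSup]
  refine iSup_le fun N => ?_
  have hpt : ∀ ω, ∑ x ∈ box d N, c * (E N).indicator (1 : Ω → ℝ≥0∞) (x +ᵥ ω) ≤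
      (3 : ℝ≥0∞) ^ d * ∑ y ∈ box d (N + N), f (y +ᵥ ω) := by
    intro ω
    let B := (box d N).filter fun x => x +ᵥ ω ∈ E N
    have hex : ∀ x : Site d, ∃ n, x +ᵥ ω ∈ E N →
        n ≤ N ∧ c * (box d n).card ≤ ∑ k ∈ box d n, f (k +ᵥ x +ᵥ ω) := by
      intro x
      by_cases hx : x +ᵥ ω ∈ E N
      · obtain ⟨n, h⟩ := hx
        exact ⟨n, fun _ => h⟩
      · exact ⟨0, fun h => absurd h hx⟩
    choose r hr using hex
    have key := mul_card_le_of_sum_box_ge (fun y => f (y +ᵥ ω)) c (N := N) B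
      (Finset.filter_subset _ _) r (fun x hx => (hr x (Finset.mem_filter.1 hx).2).1)
      (fun x hx => by
        simpa only [add_vadd] using (hr x (Finset.mem_filter.1 hx).2).2)
    refine le_trans (le_of_eq ?_) key
    rw [← Finset.mul_sum]
    congr 1
    rw [Finset.card_filter]
    push_cast
    refine Finset.sum_congr rfl fun x _ => ?_
    by_cases h : x +ᵥ ω ∈ E N <;> simp [h]
  have hint := lintegral_mono (μ := μ) hpt
  rw [lintegral_finsetSum _ (fun x _ => by
      exact ((measurable_one.indicator (hEm N)).comp (measurable_const_vadd x)).const_mul c),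
    lintegral_const_mul _ (Finset.measurable_sum _ fun k _ => hfk k),
    lintegral_finsetSum _ (fun k _ => hfk k)] at hint
  have hind : Measurable ((E N).indicator (1 : Ω → ℝ≥0∞)) := measurable_one.indicator (hEm N)
  have h1 : ∀ x : Site d, ∫⁻ ω, c * (E N).indicator (1 : Ω → ℝ≥0∞) (x +ᵥ ω) ∂μ = c * μ (E N) := by
    intro x
    have hx : Measurable fun ω => (E N).indicator (1 : Ω → ℝ≥0∞) (x +ᵥ ω) :=
      hind.comp (measurable_const_vadd x)
    rw [lintegral_const_mul _ hx, (measurePreserving_vadd x μ).lintegral_comp hind,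
      lintegral_indicator_one (hEm N)]
  have h2 : ∀ x : Site d, ∫⁻ ω, f (x +ᵥ ω) ∂μ = ∫⁻ ω, f ω ∂μ := fun x =>
    (measurePreserving_vadd x μ).lintegral_comp hf
  simp only [h1, h2, Finset.sum_const, nsmul_eq_mul] at hint
  -- Centres and radii are both bounded by `N`, so the sum runs over `Λ_{2N}`. This costs `2 ^ d`
  -- and turns `3 ^ d` into `6 ^ d`.
  have hcard : ((box d (N + N)).card : ℝ≥0∞) ≤ 2 ^ d * (box d N).card := by
    have := card_box_mul_le d N 2 (by norm_num)
    rw [two_mul] at this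
    exact_mod_cast this
  have hne : ((box d N).card : ℝ≥0∞) ≠ 0 := by exact_mod_cast (card_box_pos d N).ne'
  rw [← ENNReal.mul_le_mul_iff_right hne (ENNReal.natCast_ne_top _)]
  calc _ ≤ _ := hint
    _ ≤ 3 ^ d * (2 ^ d * (box d N).card * ∫⁻ ω, f ω ∂μ) := by gcongr
    _ = (box d N).card * ((3 * 2) ^ d * ∫⁻ ω, f ω ∂μ) := by rw [mul_pow]; ring
    _ = _ := by norm_num

/-- Weak type `(1,1)` maximal inequality for the averages over boxes. -/
theorem maximal_inequality {f : Ω → ℝ≥0∞} (hf : AEMeasurable f μ) (c : ℝ≥0∞) :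
    c * μ {ω | ∃ n, c * (box d n).card ≤ ∑ k ∈ box d n, f (k +ᵥ ω)} ≤ 6 ^ d * ∫⁻ ω, f ω ∂μ := by
  have h := maximal_inequality_of_measurable (d := d) (μ := μ) hf.measurable_mk c
  rw [lintegral_congr_ae hf.ae_eq_mk]
  refine le_trans (le_of_eq ?_) h
  congr 1
  refine measure_congr (Filter.eventuallyEq_set.2 ?_)
  filter_upwards [ae_forall_vadd (d := d) hf.ae_eq_mk] with ω hω
  simp only [hω]

end Maximal

/-! ### The pointwise ergodic theorem -/

section ErgodicTheorem

/-- The average of `f` over the translates of `ω` by the sites of the box `Λ_n`. -/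
noncomputable def boxAverage (d : ℕ) {Ω : Type*} [AddAction (Site d) Ω] (f : Ω → ℝ) (n : ℕ)
    (ω : Ω) : ℝ :=
  (∑ k ∈ box d n, f (k +ᵥ ω)) / (box d n).card

/-- The box averages of `f` converge almost everywhere to the mean of `f`. -/
def AveragesConverge (d : ℕ) {Ω : Type*} [MeasurableSpace Ω] [AddAction (Site d) Ω]
    (μ : Measure Ω) (f : Ω → ℝ) : Prop :=
  ∀ᵐ ω ∂μ, Tendsto (fun n => boxAverage d f n ω) atTop (𝓝 (∫ ω, f ω ∂μ))

variable {d : ℕ} {Ω : Type*} [AddAction (Site d) Ω]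

theorem boxAverage_add (f g : Ω → ℝ) (n : ℕ) (ω : Ω) :
    boxAverage d (f + g) n ω = boxAverage d f n ω + boxAverage d g n ω := by
  simp [boxAverage, Finset.sum_add_distrib, add_div]

theorem boxAverage_const (c : ℝ) (n : ℕ) (ω : Ω) : boxAverage d (fun _ => c) n ω = c := by
  have : ((box d n).card : ℝ) ≠ 0 := by exact_mod_cast (card_box_pos d n).ne'
  simp [boxAverage, this]

variable [MeasurableSpace Ω] {μ : Measure Ω}

theorem AveragesConverge.add {f g : Ω → ℝ} (hf : AveragesConverge d μ f)
    (hg : AveragesConverge d μ g) (hfi : Integrable f μ) (hgi : Integrable g μ) :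
    AveragesConverge d μ (f + g) := by
  filter_upwards [hf, hg] with ω h1 h2
  simp only [boxAverage_add, Pi.add_apply]
  rw [integral_add hfi hgi]
  exact h1.add h2

theorem AveragesConverge.const_mul {f : Ω → ℝ} (hf : AveragesConverge d μ f) (c : ℝ) :
    AveragesConverge d μ (fun ω => c * f ω) := by
  filter_upwards [hf] with ω h
  have : ∀ n, boxAverage d (fun ω => c * f ω) n ω = c * boxAverage d f n ω := by
    intro n
    simp [boxAverage, ← Finset.mul_sum, mul_div_assoc]
  simp only [this, integral_const_mul]
  exact h.const_mul c

theorem averagesConverge_const [IsProbabilityMeasure μ] (c : ℝ) :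
    AveragesConverge d μ (fun _ => c) := by
  refine Eventually.of_forall fun ω => ?_
  simp [boxAverage_const]

/-- Each preimage `u ⁻¹' U` is almost invariant, hence null or conull, and countably many measurable
sets separate the reals. -/
theorem ae_eq_const_of_forall_vadd_ae_eq [ErgodicVAdd (Site d) Ω μ] {u : Ω → ℝ}
    (hu : Measurable u) (h : ∀ k : Site d, (fun ω => u (k +ᵥ ω)) =ᵐ[μ] u) :
    ∃ c, u =ᵐ[μ] fun _ => c := by
  refine exists_eventuallyEq_const_of_forall_separating MeasurableSet fun U hU => ?_
  have hc := aeconst_of_forall_preimage_vadd_ae_eq (Site d) (μ := μ) (s := u ⁻¹' U)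
    (hu hU).nullMeasurableSet fun k => by
      refine eventuallyEq_set.2 ?_
      filter_upwards [h k] with ω hω
      simp only [Set.mem_preimage, hω]
  exact eventuallyConst_set.1 hc

variable [MeasurableConstVAdd (Site d) Ω]

section Invariant

variable [VAddInvariantMeasure (Site d) Ω μ]

theorem AveragesConverge.congr {f g : Ω → ℝ} (hf : AveragesConverge d μ f) (h : f =ᵐ[μ] g) :
    AveragesConverge d μ g := by
  filter_upwards [hf, ae_forall_vadd (d := d) h] with ω h1 h2
  rw [← integral_congr_ae h]
  simpa only [boxAverage, h2] using h1

/-- The functions whose averages converge form a closed set in `L¹`. -/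
theorem AveragesConverge.of_approx {f : Ω → ℝ} (hf : Integrable f μ)
    (happ : ∀ ε > 0, ∃ g : Ω → ℝ, Integrable g μ ∧ AveragesConverge d μ g ∧
      eLpNorm (f - g) 1 μ ≤ ENNReal.ofReal ε) : AveragesConverge d μ f := by
  have key : ∀ δ > 0, ∀ᵐ ω ∂μ, ∀ᶠ n in atTop,
      |boxAverage d f n ω - ∫ ω, f ω ∂μ| ≤ 3 * δ := by
    intro δ hδ
    -- Here `δ` is fixed and the approximation error `ε` is free; letting `ε → 0` makes the bad set
    -- null.
    have hbound : ∀ ε > 0, ε ≤ δ → ENNReal.ofReal δ * μ {ω | ¬ ∀ᶠ n in atTop,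
        |boxAverage d f n ω - ∫ ω, f ω ∂μ| ≤ 3 * δ} ≤ 6 ^ d * ENNReal.ofReal ε := by
      intro ε hε hεδ
      obtain ⟨g, hgi, hg, hfg⟩ := happ ε hε
      have hmax := maximal_inequality (d := d) (μ := μ) (f := fun ω => ‖(f - g) ω‖ₑ)
        (hf.sub hgi).aestronglyMeasurable.enorm (ENNReal.ofReal δ)
      rw [eLpNorm_one_eq_lintegral_enorm] at hfg
      refine le_trans ?_ (hmax.trans (by gcongr))
      gcongr 1
      refine measure_mono_ae ?_
      filter_upwards [hg] with ω hgω hbad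
      by_contra hnot
      apply hbad
      -- Off the maximal set, the averages of `f` and `g` differ by less than `δ` for all `n` at
      -- once.
      have hnot : ∀ n, ∑ k ∈ box d n, ‖(f - g) (k +ᵥ ω)‖ₑ <
          ENNReal.ofReal δ * (box d n).card := by
        intro n
        by_contra h
        exact hnot ⟨n, not_lt.1 h⟩
      have hint : |∫ ω, g ω ∂μ - ∫ ω, f ω ∂μ| ≤ ε := by
        rw [abs_sub_comm, ← integral_sub hf hgi]
        have h1 := enorm_integral_le_lintegral_enorm (μ := μ) (f - g)
        have h2 := h1.trans hfg
        rw [Real.enorm_eq_ofReal_abs, ENNReal.ofReal_le_ofReal_iff hε.le] at h2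
        exact h2
      filter_upwards [Metric.tendsto_nhds.1 hgω δ hδ] with n hn
      rw [Real.dist_eq] at hn
      have hcard : (0 : ℝ) < (box d n).card := by exact_mod_cast card_box_pos d n
      have hdiff : |boxAverage d f n ω - boxAverage d g n ω| ≤ δ := by
        have hs : ∑ k ∈ box d n, |(f - g) (k +ᵥ ω)| < δ * (box d n).card := by
          have h := hnot n
          simp only [Real.enorm_eq_ofReal_abs] at h
          rw [← ENNReal.ofReal_sum_of_nonneg (fun _ _ => abs_nonneg _),
            ← ENNReal.ofReal_natCast, ← ENNReal.ofReal_mul hδ.le,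
            ENNReal.ofReal_lt_ofReal_iff (by positivity)] at h
          exact h
        rw [boxAverage, boxAverage, ← sub_div, ← Finset.sum_sub_distrib, abs_div,
          abs_of_pos hcard, div_le_iff₀ hcard]
        exact (Finset.abs_sum_le_sum_abs _ _).trans hs.le
      calc |boxAverage d f n ω - ∫ ω, f ω ∂μ|
          = |(boxAverage d f n ω - boxAverage d g n ω) +
              (boxAverage d g n ω - ∫ ω, g ω ∂μ) + (∫ ω, g ω ∂μ - ∫ ω, f ω ∂μ)| := by ring_nf
        _ ≤ _ := abs_add_three _ _ _
        _ ≤ 3 * δ := by linarith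
    have hlim : Tendsto (fun ε : ℝ => (6 : ℝ≥0∞) ^ d * ENNReal.ofReal ε) (𝓝[>] 0) (𝓝 0) := by
      have h1 : Tendsto (fun ε : ℝ => ENNReal.ofReal ε) (𝓝[>] 0) (𝓝 0) := by
        have := (ENNReal.continuous_ofReal.tendsto 0).mono_left (nhdsWithin_le_nhds (s := Set.Ioi 0))
        simpa using this
      simpa using ENNReal.Tendsto.const_mul (a := (6 : ℝ≥0∞) ^ d) h1
        (Or.inr (ENNReal.pow_ne_top (by norm_num)))
    have hz := ge_of_tendsto hlim (b := ENNReal.ofReal δ * μ {ω | ¬ ∀ᶠ n in atTop,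
        |boxAverage d f n ω - ∫ ω, f ω ∂μ| ≤ 3 * δ}) (by
      filter_upwards [Ioc_mem_nhdsGT hδ] with ε hε
      exact hbound ε hε.1 hε.2)
    rw [nonpos_iff_eq_zero, mul_eq_zero] at hz
    rw [ae_iff]
    exact hz.resolve_left (by simpa using hδ)
  have hall : ∀ᵐ ω ∂μ, ∀ j : ℕ, ∀ᶠ n in atTop,
      |boxAverage d f n ω - ∫ ω, f ω ∂μ| ≤ 3 * (1 / ((j : ℝ) + 1)) :=
    ae_all_iff.2 fun j => key _ (by positivity)
  filter_upwards [hall] with ω hω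
  rw [Metric.tendsto_nhds]
  intro ε hε
  obtain ⟨j, hj⟩ := exists_nat_one_div_lt (show (0 : ℝ) < ε / 3 by positivity)
  filter_upwards [hω j] with n hn
  rw [Real.dist_eq]
  linarith

/-- Averages of bounded coboundaries tend to `0`. -/
theorem averagesConverge_coboundary {g : Ω → ℝ} (hgi : Integrable g μ) (h0 : ∀ ω, 0 ≤ g ω)
    (h1 : ∀ ω, g ω ≤ 1) (k : Site d) :
    AveragesConverge d μ (fun ω => g (k +ᵥ ω) - g ω) := by
  classical
  have hmean : ∫ ω, g (k +ᵥ ω) - g ω ∂μ = 0 := by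
    have hgk : Integrable (fun ω => g (k +ᵥ ω)) μ :=
      (measurePreserving_vadd k μ).integrable_comp_of_integrable hgi
    rw [integral_sub hgk hgi,
      (measurePreserving_vadd k μ).integral_comp (measurableEmbedding_const_vadd k), sub_self]
  obtain ⟨K, hK⟩ := exists_mem_box k
  refine Eventually.of_forall fun ω => ?_
  rw [hmean]
  have hgrow : ∀ n, ∀ k' ∈ box d K, ∀ F : Site d → ℝ, (∀ x, 0 ≤ F x) → (∀ x, F x ≤ 1) →
      ∑ x ∈ box d n, F (x + k') ≤
        ∑ x ∈ box d n, F x + ((box d (n + K)).card - (box d n).card) := by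
    intro n k' hk' F hF0 hF1
    have hsub : box d n ⊆ box d (n + K) := box_mono (Nat.le_add_right n K)
    calc ∑ x ∈ box d n, F (x + k') = ∑ y ∈ (box d n).image (· + k'), F y :=
          (Finset.sum_image (fun _ _ _ _ h => add_left_injective k' h)).symm
      _ ≤ ∑ y ∈ box d (n + K), F y := by
          refine Finset.sum_le_sum_of_subset_of_nonneg ?_ fun _ _ _ => hF0 _
          intro y hy
          obtain ⟨x, hx, rfl⟩ := Finset.mem_image.1 hy
          exact add_mem_box hx hk'
      _ = ∑ y ∈ box d n, F y + ∑ y ∈ box d (n + K) \ box d n, F y := by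
          rw [← Finset.sum_sdiff hsub, add_comm]
      _ ≤ ∑ y ∈ box d n, F y + ∑ y ∈ box d (n + K) \ box d n, (1 : ℝ) := by
          gcongr with y hy
          exact hF1 y
      _ = _ := by
          rw [Finset.sum_const, nsmul_one, Finset.card_sdiff_of_subset hsub,
            Nat.cast_sub (Finset.card_le_card hsub)]
  have hbd : ∀ n, |boxAverage d (fun ω => g (k +ᵥ ω) - g ω) n ω| ≤
      (box d (n + K)).card / (box d n).card - 1 := by
    intro n
    have hcard : (0 : ℝ) < (box d n).card := by exact_mod_cast card_box_pos d n
    have hcomm : ∀ x : Site d, k +ᵥ x +ᵥ ω = (x + k) +ᵥ ω := fun x => by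
      rw [← add_vadd, add_comm]
    have hu := hgrow n k hK (fun x => g (x +ᵥ ω)) (fun _ => h0 _) (fun _ => h1 _)
    -- The one-sided bound applied to the shifted function with `-k` gives the reverse inequality.
    have hl := hgrow n (-k) (neg_mem_box hK) (fun x => g ((x + k) +ᵥ ω)) (fun _ => h0 _)
      (fun _ => h1 _)
    simp only [neg_add_cancel_right] at hl
    rw [boxAverage, abs_div, abs_of_pos hcard, div_le_iff₀ hcard, sub_mul,
      div_mul_cancel₀ _ hcard.ne', one_mul, Finset.sum_sub_distrib, abs_le]
    simp only [hcomm]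
    constructor <;> linarith
  refine squeeze_zero_norm hbd ?_
  simpa using (tendsto_card_box_add_div d K).sub_const 1

end Invariant

variable [ErgodicVAdd (Site d) Ω μ] [IsProbabilityMeasure μ]

/-- The elements of `L²` whose averages converge. -/
noncomputable def convergentL2 (d : ℕ) {Ω : Type*} [MeasurableSpace Ω] [AddAction (Site d) Ω]
    [MeasurableConstVAdd (Site d) Ω] (μ : Measure Ω) [ErgodicVAdd (Site d) Ω μ]
    [IsProbabilityMeasure μ] : Submodule ℝ (Lp ℝ 2 μ) where
  carrier := {f | AveragesConverge d μ f}
  add_mem' {f g} hf hg := by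
    refine AveragesConverge.congr (hf.add hg ((Lp.memLp f).integrable (by norm_num))
      ((Lp.memLp g).integrable (by norm_num))) (Lp.coeFn_add f g).symm
  zero_mem' := by
    refine AveragesConverge.congr (averagesConverge_const 0) ?_
    exact (Lp.coeFn_zero ℝ 2 μ).symm
  smul_mem' c f hf := by
    refine AveragesConverge.congr (hf.const_mul c) ?_
    filter_upwards [Lp.coeFn_smul c f] with ω hω
    simp [hω]

theorem mem_convergentL2 {f : Lp ℝ 2 μ} : f ∈ convergentL2 d μ ↔ AveragesConverge d μ f :=
  Iff.rfl

/-- On a probability space `L²` approximation implies `L¹` approximation, so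
`AveragesConverge.of_approx` applies. -/
theorem isClosed_convergentL2 : IsClosed (convergentL2 d μ : Set (Lp ℝ 2 μ)) := by
  refine isClosed_of_closure_subset fun f hf => ?_
  refine AveragesConverge.of_approx ((Lp.memLp f).integrable (by norm_num)) fun ε hε => ?_
  obtain ⟨g, hg, hfg⟩ := Metric.mem_closure_iff.1 hf ε hε
  refine ⟨g, (Lp.memLp g).integrable (by norm_num), hg, ?_⟩
  calc eLpNorm (⇑f - ⇑g) 1 μ ≤ eLpNorm (⇑f - ⇑g) 2 μ :=
        eLpNorm_le_eLpNorm_of_exponent_le (by norm_num)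
          ((Lp.aestronglyMeasurable f).sub (Lp.aestronglyMeasurable g))
    _ = edist f g := (Lp.edist_def f g).symm
    _ ≤ ENNReal.ofReal ε := by
        rw [edist_dist]
        exact ENNReal.ofReal_le_ofReal hfg.le

/-- The subspace is closed, so it is enough that its orthogonal complement vanishes. Orthogonality
to coboundaries of indicators makes `u` invariant, ergodicity makes it constant, and orthogonality
to `1` makes it zero. -/
theorem convergentL2_eq_top : convergentL2 d μ = ⊤ := by
  have : CompleteSpace (convergentL2 d μ) := isClosed_convergentL2.completeSpace_coe
  rw [← Submodule.orthogonal_eq_bot_iff, Submodule.eq_bot_iff]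
  intro u hu
  rw [Submodule.mem_orthogonal] at hu
  have hui : Integrable u μ := (Lp.memLp u).integrable (by norm_num)
  have hset : ∀ (k : Site d) (A : Set Ω), MeasurableSet A →
      ∫ ω in (k +ᵥ ·) ⁻¹' A, u ω ∂μ = ∫ ω in A, u ω ∂μ := by
    intro k A hA
    have hA' : MeasurableSet ((k +ᵥ ·) ⁻¹' A) := measurable_const_vadd k hA
    have hmem : indicatorConstLp 2 hA' (measure_ne_top μ _) (1 : ℝ) -
        indicatorConstLp 2 hA (measure_ne_top μ _) (1 : ℝ) ∈ convergentL2 d μ := by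
      refine (averagesConverge_coboundary (μ := μ) (g := A.indicator fun _ => (1 : ℝ))
        ((integrable_const 1).indicator hA)
        (fun ω => Set.indicator_nonneg (fun _ _ => zero_le_one) ω)
        (fun ω => Set.indicator_le_self' (fun _ _ => zero_le_one) ω) k).congr ?_
      filter_upwards [Lp.coeFn_sub (indicatorConstLp 2 hA' (measure_ne_top μ _) (1 : ℝ))
        (indicatorConstLp 2 hA (measure_ne_top μ _) (1 : ℝ)),
        indicatorConstLp_coeFn (p := 2) (hs := hA') (hμs := measure_ne_top μ _) (c := (1 : ℝ)),
        indicatorConstLp_coeFn (p := 2) (hs := hA) (hμs := measure_ne_top μ _) (c := (1 : ℝ))]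
        with ω e1 e2 e3
      rw [e1, Pi.sub_apply, e2, e3]
      rfl
    have h := hu _ hmem
    rw [inner_sub_left, L2.inner_indicatorConstLp_one, L2.inner_indicatorConstLp_one] at h
    linarith
  have hinv : ∀ k : Site d, (fun ω => u (k +ᵥ ω)) =ᵐ[μ] u := by
    intro k
    have huk : Integrable (fun ω => u (k +ᵥ ω)) μ :=
      (measurePreserving_vadd k μ).integrable_comp_of_integrable hui
    refine huk.ae_eq_of_forall_setIntegral_eq _ _ hui fun A hA _ => ?_
    -- Writing `A` as the preimage of its own translate lets both change of variables and `hset`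
    -- evaluate integrals over `A`.
    have hpre : (k +ᵥ ·) ⁻¹' ((-k +ᵥ ·) ⁻¹' A) = A := by
      ext ω; simp
    have hB : MeasurableSet ((-k +ᵥ ·) ⁻¹' A : Set Ω) := measurable_const_vadd (-k) hA
    have e1 := (measurePreserving_vadd k μ).setIntegral_preimage_emb
      (measurableEmbedding_const_vadd k) u ((-k +ᵥ ·) ⁻¹' A)
    have e2 := hset k _ hB
    rw [hpre] at e1 e2
    exact e1.trans e2.symm
  obtain ⟨c, hc⟩ := ae_eq_const_of_forall_vadd_ae_eq
    (Lp.stronglyMeasurable u).measurable hinv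
  have hone : indicatorConstLp 2 MeasurableSet.univ (measure_ne_top μ _) (1 : ℝ) ∈
      convergentL2 d μ := by
    refine (averagesConverge_const (1 : ℝ)).congr ?_
    filter_upwards [indicatorConstLp_coeFn (p := 2) (hs := MeasurableSet.univ)
      (hμs := measure_ne_top μ _) (c := (1 : ℝ))] with ω hω
    rw [hω]; simp
  have h := hu _ hone
  rw [L2.inner_indicatorConstLp_one, setIntegral_univ, integral_congr_ae hc] at h
  have hc0 : c = 0 := by simpa using h
  rw [Lp.eq_zero_iff_ae_eq_zero]
  filter_upwards [hc] with ω hω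
  simp [hω, hc0]

/-- Pointwise ergodic theorem for actions of `ℤ^d` and averages over boxes. -/
theorem averagesConverge_of_integrable {f : Ω → ℝ} (hf : Integrable f μ) :
    AveragesConverge d μ f := by
  refine Integrable.induction (μ := μ) (AveragesConverge d μ) ?_ ?_ ?_ ?_ hf
  · intro c A hA _
    have hmem : indicatorConstLp 2 hA (measure_ne_top μ _) c ∈ convergentL2 d μ := by
      rw [convergentL2_eq_top]; trivial
    exact (mem_convergentL2.1 hmem).congr indicatorConstLp_coeFn
  · intro f g _ hfi hgi h1 h2
    exact h1.add h2 hfi hgi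
  · refine isClosed_of_closure_subset fun f hf => ?_
    refine AveragesConverge.of_approx (L1.integrable_coeFn f) fun ε hε => ?_
    obtain ⟨g, hg, hfg⟩ := Metric.mem_closure_iff.1 hf ε hε
    refine ⟨g, L1.integrable_coeFn g, hg, ?_⟩
    rw [← Lp.edist_def, edist_dist]
    exact ENNReal.ofReal_le_ofReal hfg.le
  · intro f g h _ h1
    exact h1.congr h

end ErgodicTheorem

/-! ### Measurability, translation and moments of cluster sizes -/

section Cluster

variable {d : ℕ}

instance instMeasurableConstVAddConfig (d : ℕ) : MeasurableConstVAdd (Site d) (Config d) where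
  measurable_const_vadd k :=
    measurable_pi_lambda _ fun e => measurable_pi_apply (shiftBond k e)

theorem measurableSet_adj (x y : Site d) : MeasurableSet {ω : Config d | (openGraph ω).Adj x y} := by
  by_cases h : (lattice d).Adj x y
  · have : {ω : Config d | (openGraph ω).Adj x y} =
        (fun ω : Config d => ω ⟨s(x, y), h⟩) ⁻¹' {true} := by
      ext ω
      exact ⟨fun ⟨_, hω⟩ => hω, fun hω => ⟨h, hω⟩⟩
    rw [this]
    have hm : Measurable fun ω : Config d => ω ⟨s(x, y), h⟩ :=
      measurable_pi_apply (X := fun _ : Bond d => Bool) _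
    exact hm (MeasurableSet.singleton true)
  · have : {ω : Config d | (openGraph ω).Adj x y} = ∅ := by
      ext ω
      exact ⟨fun ⟨h', _⟩ => h h', fun h' => h'.elim⟩
    rw [this]
    exact MeasurableSet.empty

theorem measurableSet_walk (n : ℕ) (x y : Site d) :
    MeasurableSet {ω : Config d | ∃ p : (openGraph ω).Walk x y, p.length = n} := by
  induction n generalizing x with
  | zero =>
    simp only [SimpleGraph.Walk.exists_length_eq_zero_iff]
    exact MeasurableSet.const _
  | succ n ih =>
    have : {ω : Config d | ∃ p : (openGraph ω).Walk x y, p.length = n + 1} =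
        ⋃ z, {ω | (openGraph ω).Adj x z} ∩
          {ω | ∃ p : (openGraph ω).Walk z y, p.length = n} := by
      ext ω
      simp only [Set.mem_iUnion, Set.mem_inter_iff, Set.mem_ofPred_eq]
      constructor
      · rintro ⟨p, hp⟩
        cases p with
        | nil => simp at hp
        | cons h q => exact ⟨_, h, q, by simpa using hp⟩
      · rintro ⟨z, h, q, hq⟩
        exact ⟨SimpleGraph.Walk.cons h q, by simp [hq]⟩
    rw [this]
    exact MeasurableSet.iUnion fun z => (measurableSet_adj x z).inter (ih z)

theorem measurableSet_reachable (x y : Site d) :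
    MeasurableSet {ω : Config d | (openGraph ω).Reachable x y} := by
  have : {ω : Config d | (openGraph ω).Reachable x y} =
      ⋃ n, {ω | ∃ p : (openGraph ω).Walk x y, p.length = n} := by
    ext ω
    simp only [Set.mem_iUnion, Set.mem_ofPred_eq]
    exact ⟨fun ⟨p⟩ => ⟨p.length, p, rfl⟩, fun ⟨_, p, _⟩ => ⟨p⟩⟩
  rw [this]
  exact MeasurableSet.iUnion fun n => measurableSet_walk n x y

/-- The size is a countable sum of indicators of connection events. -/
theorem measurable_encard_cluster (x : Site d) :
    Measurable fun ω : Config d => ((cluster ω x).encard : ℝ≥0∞) := by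
  have : (fun ω : Config d => ((cluster ω x).encard : ℝ≥0∞)) = fun ω =>
      ∑' y, {ω : Config d | (openGraph ω).Reachable x y}.indicator (fun _ => (1 : ℝ≥0∞)) ω := by
    funext ω
    rw [← ENNReal.tsum_set_one, tsum_subtype (cluster ω x) (fun _ => (1 : ℝ≥0∞))]
    refine tsum_congr fun y => ?_
    by_cases hy : (openGraph ω).Reachable x y
    · rw [Set.indicator_of_mem (s := cluster ω x) hy,
        Set.indicator_of_mem (s := {ω : Config d | (openGraph ω).Reachable x y}) hy]
    · rw [Set.indicator_of_notMem (s := cluster ω x) hy,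
        Set.indicator_of_notMem (s := {ω : Config d | (openGraph ω).Reachable x y}) hy]
  rw [this]
  exact Measurable.tsum fun y => measurable_const.indicator (measurableSet_reachable x y)

theorem measurable_ncard_cluster (x : Site d) :
    Measurable fun ω : Config d => (cluster ω x).ncard := by
  refine measurable_to_countable' fun k => ?_
  have : (fun ω : Config d => (cluster ω x).ncard) ⁻¹' {k} =
      (fun ω : Config d => ((cluster ω x).encard : ℝ≥0∞).toReal) ⁻¹' {(k : ℝ)} := by
    ext ω
    simp only [Set.mem_preimage, Set.mem_singleton_iff]
    have h : ((cluster ω x).encard : ℝ≥0∞).toReal = (cluster ω x).ncard := by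
      rw [Set.ncard]
      cases (cluster ω x).encard <;> simp
    rw [h, Nat.cast_inj]
  rw [this]
  exact (measurable_encard_cluster x).ennreal_toReal (MeasurableSet.singleton _)

theorem openGraph_vadd_adj (k : Site d) (ω : Config d) (x y : Site d) :
    (openGraph ω).Adj (k + x) (k + y) ↔ (openGraph (k +ᵥ ω)).Adj x y := by
  have hl : (lattice d).Adj (k + x) (k + y) ↔ (lattice d).Adj x y := by simp [lattice]
  exact ⟨fun ⟨h, hω⟩ => ⟨hl.1 h, hω⟩, fun ⟨h, hω⟩ => ⟨hl.2 h, hω⟩⟩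

/-- Translation by `k` identifies the graph of `k +ᵥ ω` with the graph of `ω`. -/
def openGraphVAddIso (k : Site d) (ω : Config d) : openGraph (k +ᵥ ω) ≃g openGraph ω where
  toEquiv := Equiv.addLeft k
  map_rel_iff' := openGraph_vadd_adj k ω _ _

/-- This turns orbit averages of the size of the cluster of the origin into spatial averages over
the sites of `Λ_n`. -/
theorem ncard_cluster_vadd (k : Site d) (ω : Config d) :
    (cluster (k +ᵥ ω) 0).ncard = (cluster ω k).ncard := by
  have h0 : openGraphVAddIso k ω 0 = k := add_zero k
  have h : cluster ω k = (openGraphVAddIso k ω) '' cluster (k +ᵥ ω) 0 := by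
    ext y
    constructor
    · intro hy
      refine ⟨(openGraphVAddIso k ω).symm y, ?_, by simp⟩
      have := (openGraphVAddIso k ω).reachable_iff (u := 0)
        (v := (openGraphVAddIso k ω).symm y)
      rw [h0, RelIso.apply_symm_apply] at this
      exact this.1 hy
    · rintro ⟨z, hz, rfl⟩
      have := (openGraphVAddIso k ω).reachable_iff.2 hz
      rwa [h0] at this
  rw [h, Set.ncard_image_of_injective _ (openGraphVAddIso k ω).injective]

theorem chiF_lt_top (hd : 1 ≤ d) {φ : Measure (Config d)} (hM : MomentCondition φ) :
    chiF φ < ∞ := by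
  obtain ⟨α, hα, h⟩ := hM
  refine lt_of_le_of_lt (ENNReal.tsum_le_tsum fun k => ?_) h
  rcases Nat.eq_zero_or_pos k with rfl | hk
  · simp
  · gcongr
    have h1 : (1 : ℝ) ≤ α := le_trans (by exact_mod_cast hd) hα.le
    calc (k : ℝ≥0∞) = (k : ℝ≥0∞) ^ (1 : ℝ) := by simp
      _ ≤ (k : ℝ≥0∞) ^ α := ENNReal.rpow_le_rpow_of_exponent_le (by exact_mod_cast hk) h1

/-- `ncard` is `0` on infinite sets, so it is exactly `|C(0)| 1_{|C(0)| < ∞}`. -/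
theorem lintegral_ncard_cluster (φ : Measure (Config d)) :
    ∫⁻ ω, ((cluster ω 0).ncard : ℝ≥0∞) ∂φ = chiF φ := by
  have h1 : ∫⁻ ω, ((cluster ω 0).ncard : ℝ≥0∞) ∂φ =
      ∫⁻ k, (k : ℝ≥0∞) ∂(φ.map fun ω => (cluster ω 0).ncard) :=
    (lintegral_map (f := fun k : ℕ => (k : ℝ≥0∞)) measurable_from_top
      (measurable_ncard_cluster 0)).symm
  rw [h1, lintegral_countable', chiF]
  refine tsum_congr fun k => ?_
  -- At `k = 0` the two events differ, since `ncard = 0` includes infinite clusters; the factor `k`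
  -- removes this term.
  rcases Nat.eq_zero_or_pos k with rfl | hk
  · simp
  · rw [Measure.map_apply (measurable_ncard_cluster 0) (MeasurableSet.singleton _)]
    congr 2
    ext ω
    simp only [Set.mem_preimage, Set.mem_singleton_iff, Set.mem_ofPred_eq]
    rw [Set.ncard]
    cases (cluster ω 0).encard with
    | top => simpa using hk.ne
    | coe n => simp

theorem integrable_ncard_cluster {φ : Measure (Config d)} (h : chiF φ < ∞) :
    Integrable (fun ω => ((cluster ω 0).ncard : ℝ)) φ := by
  refine ⟨((measurable_from_top (f := fun k : ℕ => (k : ℝ))).comp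
    (measurable_ncard_cluster 0)).aestronglyMeasurable, ?_⟩
  simpa [HasFiniteIntegral, lintegral_ncard_cluster] using h

theorem integral_ncard_cluster (φ : Measure (Config d)) :
    ∫ ω, ((cluster ω 0).ncard : ℝ) ∂φ = (chiF φ).toReal := by
  rw [integral_eq_lintegral_of_nonneg_ae (Eventually.of_forall fun _ => Nat.cast_nonneg _)
    ((measurable_from_top (f := fun k : ℕ => (k : ℝ))).comp
    (measurable_ncard_cluster 0)).aestronglyMeasurable, ← lintegral_ncard_cluster]
  simp

/-- The size of a finite cluster, replaced by `0` when it exceeds `M`. -/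
noncomputable def truncatedSize (M : ℕ) (ω : Config d) (x : Site d) : ℝ :=
  if (cluster ω x).ncard ≤ M then ((cluster ω x).ncard : ℝ) else 0

theorem truncatedSize_nonneg (M : ℕ) (ω : Config d) (x : Site d) : 0 ≤ truncatedSize M ω x := by
  unfold truncatedSize; split_ifs <;> positivity

theorem truncatedSize_le (M : ℕ) (ω : Config d) (x : Site d) :
    truncatedSize M ω x ≤ (cluster ω x).ncard := by
  unfold truncatedSize; split_ifs <;> simp

theorem measurable_truncatedSize (M : ℕ) (x : Site d) :
    Measurable fun ω : Config d => truncatedSize M ω x :=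
  (measurable_from_top (f := fun k : ℕ => if k ≤ M then (k : ℝ) else 0)).comp
    (measurable_ncard_cluster x)

theorem integrable_truncatedSize {φ : Measure (Config d)} (h : chiF φ < ∞) (M : ℕ) :
    Integrable (fun ω => truncatedSize M ω 0) φ := by
  refine (integrable_ncard_cluster h).mono' (measurable_truncatedSize M 0).aestronglyMeasurable
    (Eventually.of_forall fun ω => ?_)
  rw [Real.norm_of_nonneg (truncatedSize_nonneg M ω 0)]
  exact truncatedSize_le M ω 0

theorem tendsto_integral_truncatedSize {φ : Measure (Config d)} (h : chiF φ < ∞) :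
    Tendsto (fun M => ∫ ω, truncatedSize M ω 0 ∂φ) atTop (𝓝 (chiF φ).toReal) := by
  rw [← integral_ncard_cluster]
  refine tendsto_integral_of_dominated_convergence (fun ω => ((cluster ω 0).ncard : ℝ))
    (fun M => (measurable_truncatedSize M 0).aestronglyMeasurable) (integrable_ncard_cluster h)
    (fun M => Eventually.of_forall fun ω => ?_) (Eventually.of_forall fun ω => ?_)
  · rw [Real.norm_of_nonneg (truncatedSize_nonneg M ω 0)]
    exact truncatedSize_le M ω 0
  · refine tendsto_const_nhds.congr' ?_
    filter_upwards [eventually_ge_atTop (cluster ω 0).ncard] with M hM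
    simp [truncatedSize, hM]

theorem ae_tendsto_ncard_cluster {φ : Measure (Config d)} [IsProbabilityMeasure φ]
    [ErgodicVAdd (Site d) (Config d) φ] (h : chiF φ < ∞) :
    ∀ᵐ ω ∂φ, Tendsto (fun n => (∑ x ∈ box d n, ((cluster ω x).ncard : ℝ)) / (box d n).card)
      atTop (𝓝 (chiF φ).toReal) := by
  filter_upwards [averagesConverge_of_integrable (d := d) (integrable_ncard_cluster h)] with ω hω
  simpa only [boxAverage, ncard_cluster_vadd, integral_ncard_cluster] using hω

theorem ae_tendsto_truncatedSize {φ : Measure (Config d)} [IsProbabilityMeasure φ]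
    [ErgodicVAdd (Site d) (Config d) φ] (h : chiF φ < ∞) (M : ℕ) :
    ∀ᵐ ω ∂φ, Tendsto (fun n => (∑ x ∈ box d n, truncatedSize M ω x) / (box d n).card)
      atTop (𝓝 (∫ ω, truncatedSize M ω 0 ∂φ)) := by
  filter_upwards [averagesConverge_of_integrable (d := d) (integrable_truncatedSize h M)]
    with ω hω
  simpa only [boxAverage, truncatedSize, ncard_cluster_vadd] using hω

end Cluster

/-! ### Asymptotics of the cluster weights -/

section Weights

variable {d : ℕ}

theorem abs_sub_le_walk_length {ω : Config d} {x y : Site d} (p : (openGraph ω).Walk x y)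
    (i : Fin d) : |y i - x i| ≤ p.length := by
  induction p with
  | nil => simp
  | @cons u v w h q ih =>
    have hstep : |u i - v i| ≤ 1 := by
      obtain ⟨hl, -⟩ := h
      have hl : ∑ j, |u j - v j| = 1 := hl
      rw [← hl]
      exact Finset.single_le_sum (f := fun j => |u j - v j|) (fun _ _ => abs_nonneg _)
        (Finset.mem_univ i)
    have := abs_sub_le (w i) (v i) (u i)
    rw [abs_sub_comm (v i)] at this
    rw [SimpleGraph.Walk.length_cons]
    push_cast
    linarith

/-- A self-avoiding open path from `x` to `y` stays in the cluster, so it has fewer steps than the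
cluster has sites, and each step moves a coordinate by at most `1`. -/
theorem sub_mem_box_of_mem_cluster {ω : Config d} {x y : Site d} (hy : y ∈ cluster ω x)
    (hx : x ∉ infiniteSites ω) : y - x ∈ box d (cluster ω x).ncard := by
  classical
  have hfin : (cluster ω x).Finite := Set.not_infinite.1 hx
  obtain ⟨p, hp⟩ := SimpleGraph.Reachable.exists_isPath hy
  have hsub : (p.support.toFinset : Set (Site d)) ⊆ cluster ω x := by
    intro z hz
    have hz : z ∈ p.support := by simpa using hz
    exact ⟨p.takeUntil z hz⟩
  have hlen : p.length + 1 ≤ (cluster ω x).ncard := by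
    rw [← SimpleGraph.Walk.length_support, ← List.toFinset_card_of_nodup hp.support_nodup,
      ← Set.ncard_coe_finset]
    exact Set.ncard_le_ncard hsub hfin
  refine mem_box.2 fun i => (abs_sub_le_walk_length p i).trans ?_
  exact_mod_cast (Nat.le_succ _).trans hlen

open Classical in
/-- The sites of `Λ_n` that belong to a finite cluster. -/
noncomputable def finiteSites (ω : Config d) (n : ℕ) : Finset (Site d) :=
  (box d n).filter fun x => x ∉ infiniteSites ω

open Classical in
/-- The finite clusters that meet `Λ_n`. -/
noncomputable def finiteClusters (ω : Config d) (n : ℕ) :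
    Finset (openGraph ω).ConnectedComponent :=
  (finiteSites ω n).image (openGraph ω).connectedComponentMk

open Classical in
/-- The number of sites of `Λ_n` in the finite cluster `C`. -/
noncomputable def clusterCount (ω : Config d) (n : ℕ)
    (C : (openGraph ω).ConnectedComponent) : ℕ :=
  ((finiteSites ω n).filter fun x => (openGraph ω).connectedComponentMk x = C).card

theorem mem_finiteSites {ω : Config d} {n : ℕ} {x : Site d} :
    x ∈ finiteSites ω n ↔ x ∈ box d n ∧ x ∉ infiniteSites ω := by
  simp [finiteSites]

theorem ncard_cluster_of_mem_infiniteSites {ω : Config d} {x : Site d}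
    (hx : x ∈ infiniteSites ω) : (cluster ω x).ncard = 0 :=
  Set.Infinite.ncard hx

theorem cluster_congr {ω : Config d} {x y : Site d} (h : (openGraph ω).Reachable x y) :
    cluster ω x = cluster ω y := by
  ext z
  exact ⟨fun hz => h.symm.trans hz, fun hz => h.trans hz⟩

theorem clusterCount_le_ncard {ω : Config d} {x : Site d} (hx : x ∉ infiniteSites ω) (n : ℕ) :
    clusterCount ω n ((openGraph ω).connectedComponentMk x) ≤ (cluster ω x).ncard := by
  classical
  rw [clusterCount, ← Set.ncard_coe_finset]
  refine Set.ncard_le_ncard (fun y hy => ?_) (Set.not_infinite.1 hx)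
  exact (SimpleGraph.ConnectedComponent.exact (Finset.mem_filter.1 (Finset.mem_coe.1 hy)).2).symm

theorem ncard_le_clusterCount {ω : Config d} {x : Site d} {n M : ℕ} (hxn : x ∈ box d n)
    (hx : x ∉ infiniteSites ω) (hM : (cluster ω x).ncard ≤ M) :
    (cluster ω x).ncard ≤ clusterCount ω (n + M) ((openGraph ω).connectedComponentMk x) := by
  classical
  rw [clusterCount, ← Set.ncard_coe_finset]
  refine Set.ncard_le_ncard (fun y hy => ?_) (Finset.finite_toSet _)
  refine Finset.mem_coe.2 (Finset.mem_filter.2 ⟨mem_finiteSites.2 ⟨?_, ?_⟩, ?_⟩)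
  · have := add_mem_box hxn (box_mono hM (sub_mem_box_of_mem_cluster hy hx))
    rwa [add_sub_cancel] at this
  · exact mt (mem_infiniteSites_congr hy).2 hx
  · exact SimpleGraph.ConnectedComponent.sound (SimpleGraph.Reachable.symm hy)

/-- A cluster with `N` sites in the box contributes `N` once for each of these sites. -/
theorem sum_sq_clusterCount (ω : Config d) (n : ℕ) :
    ∑ C ∈ finiteClusters ω n, (clusterCount ω n C : ℝ) ^ 2 =
      ∑ x ∈ finiteSites ω n,
        (clusterCount ω n ((openGraph ω).connectedComponentMk x) : ℝ) := by
  classical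
  rw [Finset.sum_comp (fun C => (clusterCount ω n C : ℝ)) (openGraph ω).connectedComponentMk,
    finiteClusters]
  refine Finset.sum_congr rfl fun C _ => ?_
  rw [nsmul_eq_mul, sq, clusterCount]

theorem sum_sq_clusterCount_le (ω : Config d) (n : ℕ) :
    ∑ C ∈ finiteClusters ω n, (clusterCount ω n C : ℝ) ^ 2 ≤
      ∑ x ∈ box d n, ((cluster ω x).ncard : ℝ) := by
  rw [sum_sq_clusterCount]
  refine (Finset.sum_le_sum fun x hx => ?_).trans (Finset.sum_le_sum_of_subset_of_nonneg
    (fun x hx => (mem_finiteSites.1 hx).1) fun _ _ _ => Nat.cast_nonneg _)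
  exact_mod_cast clusterCount_le_ncard (mem_finiteSites.1 hx).2 n

/-- A cluster of at most `M` sites that meets `Λ_n` lies inside `Λ_{n+M}` and is counted there in
full; larger ones contribute `0` on the left. -/
theorem sum_truncatedSize_le (ω : Config d) (n M : ℕ) :
    ∑ x ∈ box d n, truncatedSize M ω x ≤
      ∑ C ∈ finiteClusters ω (n + M), (clusterCount ω (n + M) C : ℝ) ^ 2 := by
  classical
  rw [sum_sq_clusterCount]
  have hsub : finiteSites ω n ⊆ finiteSites ω (n + M) := fun x hx => by
    rw [mem_finiteSites] at hx ⊢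
    exact ⟨box_mono (Nat.le_add_right n M) hx.1, hx.2⟩
  calc ∑ x ∈ box d n, truncatedSize M ω x = ∑ x ∈ finiteSites ω n, truncatedSize M ω x := by
        refine (Finset.sum_subset (fun x hx => (mem_finiteSites.1 hx).1) fun x hx hx' => ?_).symm
        have hinf : x ∈ infiniteSites ω := by
          by_contra h
          exact hx' (mem_finiteSites.2 ⟨hx, h⟩)
        simp [truncatedSize, ncard_cluster_of_mem_infiniteSites hinf]
    _ ≤ ∑ x ∈ finiteSites ω n,
          (clusterCount ω (n + M) ((openGraph ω).connectedComponentMk x) : ℝ) := by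
        refine Finset.sum_le_sum fun x hx => ?_
        rw [mem_finiteSites] at hx
        unfold truncatedSize
        split_ifs with h
        · exact_mod_cast ncard_le_clusterCount hx.1 hx.2 h
        · positivity
    _ ≤ _ := Finset.sum_le_sum_of_subset_of_nonneg hsub fun _ _ _ => Nat.cast_nonneg _

/-- If `C` has more than `M` sites, each of its `N` sites in `Λ_n` loses `|C| ≥ N` under truncation,
so the total loss is at least `N²`. Otherwise `N ≤ M`. -/
theorem sq_clusterCount_le (ω : Config d) (n M : ℕ) {C : (openGraph ω).ConnectedComponent}
    (hC : C ∈ finiteClusters ω n) :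
    (clusterCount ω n C : ℝ) ^ 2 ≤ (M : ℝ) ^ 2 + (∑ x ∈ box d n, ((cluster ω x).ncard : ℝ) -
      ∑ x ∈ box d n, truncatedSize M ω x) := by
  classical
  have hnn : ∀ y, 0 ≤ ((cluster ω y).ncard : ℝ) - truncatedSize M ω y := fun y =>
    sub_nonneg.2 (truncatedSize_le M ω y)
  rw [← Finset.sum_sub_distrib]
  obtain ⟨x, hx, rfl⟩ := Finset.mem_image.1 hC
  have hxI := (mem_finiteSites.1 hx).2
  have hle := clusterCount_le_ncard hxI n
  by_cases hM : (cluster ω x).ncard ≤ M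
  · have h1 : (clusterCount ω n ((openGraph ω).connectedComponentMk x) : ℝ) ≤ M := by
      exact_mod_cast hle.trans hM
    have h2 : 0 ≤ ∑ y ∈ box d n, (((cluster ω y).ncard : ℝ) - truncatedSize M ω y) :=
      Finset.sum_nonneg fun y _ => hnn y
    have h3 : (clusterCount ω n ((openGraph ω).connectedComponentMk x) : ℝ) ^ 2 ≤ (M : ℝ) ^ 2 := by
      gcongr
    linarith
  · set A := (finiteSites ω n).filter fun y => (openGraph ω).connectedComponentMk y =
      (openGraph ω).connectedComponentMk x with hA
    have hN : clusterCount ω n ((openGraph ω).connectedComponentMk x) = A.card := by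
      rw [clusterCount]
    have h1 : (clusterCount ω n ((openGraph ω).connectedComponentMk x) : ℝ) ^ 2 ≤
        ∑ y ∈ A, (((cluster ω y).ncard : ℝ) - truncatedSize M ω y) := by
      calc _ = ∑ y ∈ A, (clusterCount ω n ((openGraph ω).connectedComponentMk x) : ℝ) := by
            rw [Finset.sum_const, nsmul_eq_mul, ← hN, sq]
        _ ≤ _ := by
            refine Finset.sum_le_sum fun y hy => ?_
            have hyx := SimpleGraph.ConnectedComponent.exact (Finset.mem_filter.1 hy).2
            rw [truncatedSize, cluster_congr hyx, if_neg hM, sub_zero]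
            exact_mod_cast hle
    have h2 : ∑ y ∈ A, (((cluster ω y).ncard : ℝ) - truncatedSize M ω y) ≤
        ∑ y ∈ box d n, (((cluster ω y).ncard : ℝ) - truncatedSize M ω y) :=
      Finset.sum_le_sum_of_subset_of_nonneg
        (fun y hy => (mem_finiteSites.1 (Finset.mem_filter.1 hy).1).1) fun y _ _ => hnn y
    nlinarith [sq_nonneg (M : ℝ)]

/-- The weight of the colour of the cluster `C` in the normalized sum. -/
noncomputable def clusterWeight (ω : Config d) (n : ℕ)
    (C : (openGraph ω).ConnectedComponent) : ℝ :=
  clusterCount ω n C / Real.sqrt (box d n).card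

theorem clusterWeight_sq (ω : Config d) (n : ℕ) (C : (openGraph ω).ConnectedComponent) :
    clusterWeight ω n C ^ 2 = (clusterCount ω n C : ℝ) ^ 2 / (box d n).card := by
  rw [clusterWeight, div_pow, Real.sq_sqrt (Nat.cast_nonneg _)]

variable {ω : Config d} {χ : ℝ} {χM : ℕ → ℝ}

/-- The full sizes bound the sum from above; the sizes truncated at `M` bound it from below up to a
boundary layer of width `M`, and then `M` is taken large. -/
theorem tendsto_sum_sq_clusterWeight
    (h : Tendsto (fun n => (∑ x ∈ box d n, ((cluster ω x).ncard : ℝ)) / (box d n).card)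
      atTop (𝓝 χ))
    (hM : ∀ M, Tendsto (fun n => (∑ x ∈ box d n, truncatedSize M ω x) / (box d n).card)
      atTop (𝓝 (χM M)))
    (hχ : Tendsto χM atTop (𝓝 χ)) :
    Tendsto (fun n => ∑ C ∈ finiteClusters ω n, clusterWeight ω n C ^ 2) atTop (𝓝 χ) := by
  simp only [clusterWeight_sq, ← Finset.sum_div]
  refine tendsto_order.2 ⟨fun a ha => ?_, fun a ha => ?_⟩
  · obtain ⟨M, hMa⟩ := (hχ.eventually (lt_mem_nhds ha)).exists
    have hlow : Tendsto (fun n => (∑ x ∈ box d n, truncatedSize M ω x) / (box d n).card /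
        ((box d (n + M)).card / (box d n).card)) atTop (𝓝 (χM M)) := by
      have := (hM M).div (tendsto_card_box_add_div d M) one_ne_zero
      rwa [div_one] at this
    have hev := hlow.eventually (lt_mem_nhds hMa)
    rw [← map_add_atTop_eq_nat M, eventually_map]
    filter_upwards [hev] with n hn
    have hcard : ((box d n).card : ℝ) ≠ 0 := by exact_mod_cast (card_box_pos d n).ne'
    rw [div_div_div_cancel_right₀ hcard] at hn
    refine lt_of_lt_of_le hn ?_
    gcongr
    exact sum_truncatedSize_le ω n M
  · filter_upwards [h.eventually (gt_mem_nhds ha)] with n hn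
    refine lt_of_le_of_lt ?_ hn
    gcongr
    exact sum_sq_clusterCount_le ω n

theorem eventually_clusterWeight_le (hd : 1 ≤ d)
    (h : Tendsto (fun n => (∑ x ∈ box d n, ((cluster ω x).ncard : ℝ)) / (box d n).card)
      atTop (𝓝 χ))
    (hM : ∀ M, Tendsto (fun n => (∑ x ∈ box d n, truncatedSize M ω x) / (box d n).card)
      atTop (𝓝 (χM M)))
    (hχ : Tendsto χM atTop (𝓝 χ)) (ε : ℝ) (hε : 0 < ε) :
    ∀ᶠ n in atTop, ∀ C ∈ finiteClusters ω n, |clusterWeight ω n C| ≤ ε := by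
  -- Choose `M` with truncation loss `χ - χM M` below `ε ^ 2`; the remaining `M ^ 2 / |Λ_n|`
  -- vanishes because `d ≥ 1`.
  obtain ⟨M, hMa⟩ := (hχ.eventually (lt_mem_nhds (sub_lt_self χ (pow_pos hε 2)))).exists
  have hlim : Tendsto (fun n => (M : ℝ) ^ 2 / (box d n).card +
      ((∑ x ∈ box d n, ((cluster ω x).ncard : ℝ)) / (box d n).card -
        (∑ x ∈ box d n, truncatedSize M ω x) / (box d n).card)) atTop (𝓝 (0 + (χ - χM M))) :=
    (tendsto_const_nhds.div_atTop (tendsto_card_box hd)).add (h.sub (hM M))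
  filter_upwards [hlim.eventually (gt_mem_nhds (show 0 + (χ - χM M) < ε ^ 2 by linarith))]
    with n hn C hC
  refine abs_le_of_sq_le_sq ?_ hε.le
  rw [clusterWeight_sq]
  refine le_trans ?_ hn.le
  rw [← sub_div, ← add_div]
  gcongr
  exact sq_clusterCount_le ω n M hC

end Weights

/-! ### From cluster weights to the limit law -/

section Colouring

variable {d : ℕ}

theorem measurable_normalizedSum (ω : Config d) (m : ℝ) (n : ℕ) :
    Measurable (normalizedSum ω m n) := by
  unfold normalizedSum
  fun_prop

/-- Sites in infinite clusters are excluded, so `r` plays no role; grouping the others by cluster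
leaves a weighted sum of independent colours. -/
theorem normalizedSum_paint (ω : Config d) (m r : ℝ) (n : ℕ)
    (c : (openGraph ω).ConnectedComponent → ℝ) :
    normalizedSum ω m n (paint ω r c) =
      ∑ C ∈ finiteClusters ω n, clusterWeight ω n C * (c C - m) := by
  classical
  have h : ∑ x ∈ finiteSites ω n, (paint ω r c x - m) =
      ∑ x ∈ finiteSites ω n, (c ((openGraph ω).connectedComponentMk x) - m) := by
    refine Finset.sum_congr rfl fun x hx => ?_
    rw [paint, if_neg (mem_finiteSites.1 hx).2]
  have h2 : normalizedSum ω m n (paint ω r c) =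
      (∑ x ∈ finiteSites ω n, (paint ω r c x - m)) / Real.sqrt (box d n).card := by
    rw [normalizedSum, finiteSites]
  rw [h2, h, Finset.sum_comp (fun C => c C - m) (openGraph ω).connectedComponentMk,
    Finset.sum_div, finiteClusters]
  refine Finset.sum_congr rfl fun C _ => ?_
  rw [clusterWeight, clusterCount, nsmul_eq_mul, div_mul_eq_mul_div]

theorem charFun_map_normalizedSum (ω : Config d) (ν : Measure ℝ) [IsProbabilityMeasure ν]
    (m r : ℝ) (n : ℕ) (t : ℝ) :
    charFun ((colourMeasure ω ν r).map (normalizedSum ω m n)) t =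
      ∏ C ∈ finiteClusters ω n,
        charFun (ν.map fun x => x - m) (clusterWeight ω n C * t) := by
  set Q := Measure.infinitePi fun _ : (openGraph ω).ConnectedComponent => ν with hQ
  have hX : ∀ C, Measurable fun c : (openGraph ω).ConnectedComponent → ℝ => c C - m :=
    fun C => Measurable.sub (measurable_pi_apply C) measurable_const
  have hind : iIndepFun (fun C (c : (openGraph ω).ConnectedComponent → ℝ) =>
      clusterWeight ω n C * (c C - m)) Q :=
    iIndepFun_infinitePi (X := fun C x => clusterWeight ω n C * (x - m)) fun _ => by fun_prop
  have hmap : (colourMeasure ω ν r).map (normalizedSum ω m n) =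
      Q.map fun c => ∑ C ∈ finiteClusters ω n, clusterWeight ω n C * (c C - m) := by
    rw [colourMeasure, Measure.map_map (measurable_normalizedSum ω m n) (measurable_paint ω r)]
    congr 1
    funext c
    exact normalizedSum_paint ω m r n c
  rw [hmap, (hind.restrict _).charFun_map_fun_finsetSum_eq_prod
    (fun C _ => ((hX C).const_mul _).aemeasurable), Finset.prod_apply]
  refine Finset.prod_congr rfl fun C _ => ?_
  rw [charFun_map_mul_comp (hX C).aemeasurable]
  congr 1
  rw [← Measure.infinitePi_map_eval (fun _ : (openGraph ω).ConnectedComponent => ν) C,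
    Measure.map_map (by fun_prop) (by fun_prop)]
  rfl

theorem tendstoInDistribution_normalizedSum {ω : Config d} {χ : ℝ} {ν : Measure ℝ}
    [IsProbabilityMeasure ν] (hν : MemLp (fun x : ℝ => x) 2 ν) {m σsq : ℝ}
    (hm : m = ∫ x, x ∂ν) (hσ : σsq = ∫ x, (x - m) ^ 2 ∂ν) (r : ℝ)
    (hsum : Tendsto (fun n => ∑ C ∈ finiteClusters ω n, clusterWeight ω n C ^ 2) atTop (𝓝 χ))
    (hmax : ∀ ε > 0, ∀ᶠ n in atTop, ∀ C ∈ finiteClusters ω n, |clusterWeight ω n C| ≤ ε) :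
    TendstoInDistribution (fun n => normalizedSum ω m n) atTop (id : ℝ → ℝ)
      (fun _ => colourMeasure ω ν r) (gaussianReal 0 (χ * σsq).toNNReal) where
  forall_aemeasurable n := (measurable_normalizedSum ω m n).aemeasurable
  tendsto := by
    refine ProbabilityMeasure.tendsto_iff_tendsto_charFun.2 fun t => ?_
    have hsub : Measurable fun x : ℝ => x - m := by fun_prop
    have : IsProbabilityMeasure (ν.map fun x => x - m) :=
      Measure.isProbabilityMeasure_map hsub.aemeasurable
    have hL2 : MemLp id 2 (ν.map fun x => x - m) := by
      rw [memLp_map_measure_iff aestronglyMeasurable_id hsub.aemeasurable]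
      exact hν.sub (memLp_const m)
    have h0 : ∫ x, x ∂(ν.map fun x => x - m) = 0 := by
      rw [integral_map hsub.aemeasurable (by fun_prop),
        integral_sub (hν.integrable (by norm_num)) (integrable_const m), ← hm]
      simp
    have h2 : ∫ x, x ^ 2 ∂(ν.map fun x => x - m) = σsq := by
      rw [integral_map hsub.aemeasurable (by fun_prop), hσ]
    have h := tendsto_prod_charFun hL2 h0 (finiteClusters ω) (clusterWeight ω) hsum hmax t
    rw [h2] at h
    simpa [charFun_map_normalizedSum] using h

end Colouring

end RandomGraphColouring

theorem mainTheorem4 (d : ℕ) (hd : 1 ≤ d)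
    (φ : Measure (RandomGraphColouring.Config d)) [IsProbabilityMeasure φ]
    (hE : ErgodicVAdd (RandomGraphColouring.Site d) (RandomGraphColouring.Config d) φ)
    (hM : RandomGraphColouring.MomentCondition φ)
    (ν : Measure ℝ) [IsProbabilityMeasure ν] (hν : MemLp (fun x : ℝ => x) 2 ν)
    (m σsq : ℝ) (hm : m = ∫ x, x ∂ν) (hσ : σsq = ∫ x, (x - m) ^ 2 ∂ν) (r : ℝ) :
    RandomGraphColouring.chiF φ < ∞ ∧
    ∀ᵐ G ∂φ,
      TendstoInDistribution
        (fun (n : ℕ) => RandomGraphColouring.normalizedSum G m n) atTop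
        (id : ℝ → ℝ)
        (fun _ => RandomGraphColouring.colourMeasure G ν r)
        (gaussianReal 0 ((RandomGraphColouring.chiF φ).toReal * σsq).toNNReal) := by
  have hχ := RandomGraphColouring.chiF_lt_top hd hM
  refine ⟨hχ, ?_⟩
  -- Only countably many truncation levels occur, so one almost sure event of graphs serves them
  -- all.
  filter_upwards [RandomGraphColouring.ae_tendsto_ncard_cluster hχ,
    ae_all_iff.2 (RandomGraphColouring.ae_tendsto_truncatedSize hχ)] with G h1 h2
  have h3 := RandomGraphColouring.tendsto_integral_truncatedSize hχ
  exact RandomGraphColouring.tendstoInDistribution_normalizedSum hν hm hσ r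
    (RandomGraphColouring.tendsto_sum_sq_clusterWeight h1 h2 h3)
    (RandomGraphColouring.eventually_clusterWeight_le hd h1 h2 h3)
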